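/- All algebras here are real. A JB algebra is a Banach space $A$ with a commutative bilinear (not necessarily associative) product $\circ$ such that $a\circ(b\circ a^2)=(a\circ b)\circ a^2$, $\|a\circ b\|\le\|a\|\,\|b\|$, $\|a^2\|=\|a\|^2$ and $\|a^2\|\le\|a^2+b^2\|$ for all $a,b$; a JBW algebra is a JB algebra that is isometrically the dual of a Banach space. Let $A$ be a JBW algebra with unit $\mathbf 1$. Let $ASU(A)$ be the set of all norm-closed associative subalgebras of $A$ containing $\mathbf 1$, ordered by inclusion. The center of $A$ is the set of all $z\in A$ with $z\circ(a\circ c)=a\circ(z\circ c)$ for all $a,c\in A$; $A$ is a factor if $A\neq 0$ and its center is $\mathbb R\mathbf 1$. A minimal projection is an element $p\ne0$ with $p\circ p=p$ and $U_p(A)=\mathbb R p$, where $U_p(a)=2p\circ(p\circ a)-p^2\circ a$. A Type $I_2$ factor is a factor in which $\mathbf 1=p+q$ with minimal projections $p,q$ such that $p\circ q=0$. A spin factor is an algebra isometrically isomorphic to $H\oplus\mathbb R\mathbf 1$, where $H$ is a real Hilbert space of (finite or infinite) dimension at least $2$, with norm $\|a+\lambda\mathbf 1\|=\|a\|+|\lambda|$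 and product $$(a+\lambda\mathbf 1)\circ(b+\mu\mathbf 1)=(\mu a+\lambda b)+(\langle a,b\rangle+\lambda\mu)\mathbf 1 .$$ **Proposition.** $ASU(A)$ has a maximal element of dimension two if and only if $A$ is a Type $I_2$ factor or $A$ is isometrically isomorphic to $\mathbb R\oplus\mathbb R$ (with coordinatewise product and maximum norm). Moreover, $A$ is a Type $I_2$ factor if and only if $A$ is a spin factor. -/

import Mathlib

universe u

/-- A (unital) JB algebra: a real Banach space with a commutative bilinear product satisfying the
Jordan identity, a submultiplicative norm, and `‖a²‖ = ‖a‖²`, `‖a²‖ ≤ ‖a² + b²‖`.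
The product is not assumed to be associative. -/
class JBAlgebra (A : Type u) extends NormedAddCommGroup A, NonAssocCommRing A, NormedSpace ℝ A,
    CompleteSpace A, IsCommJordan A where
  /-- Homogeneity of the product in the first (hence, by commutativity, in both) variables. -/
  smul_mul' : ∀ (r : ℝ) (a b : A), (r • a) * b = r • (a * b)
  norm_mul_le' : ∀ a b : A, ‖a * b‖ ≤ ‖a‖ * ‖b‖
  norm_sq' : ∀ a : A, ‖a * a‖ = ‖a‖ ^ 2
  norm_sq_le' : ∀ a b : A, ‖a * a‖ ≤ ‖a * a + b * b‖

/-- A JBW algebra: a JB algebra that is (isometrically isomorphic to) the dual of a Banach space. -/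
class JBWAlgebra (A : Type u) extends JBAlgebra A where
  exists_predual : ∃ (X : Type u) (_ : NormedAddCommGroup X) (_ : NormedSpace ℝ X)
    (_ : CompleteSpace X), Nonempty (StrongDual ℝ X ≃ₗᵢ[ℝ] A)

namespace JBAlgebra

section

variable (A : Type u) [JBAlgebra A]

/-- The set of all unital associative JB subalgebras of `A`: norm-closed subalgebras that contain
the unit of `A` and on which the product is associative. -/
def ASU : Set (NonUnitalSubalgebra ℝ A) :=
  {C | IsClosed (C : Set A) ∧ (1 : A) ∈ C ∧
    ∀ x ∈ C, ∀ y ∈ C, ∀ z ∈ C, (x * y) * z = x * (y * z)}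

variable {A}

/-- Elements `a`, `b` operator commute: `T_a T_b = T_b T_a`, where `T_a c = a ∘ c`. -/
def OperatorCommute (a b : A) : Prop := ∀ c : A, a * (b * c) = b * (a * c)

/-- The map `U_a b = 2 a ∘ (a ∘ b) - a² ∘ b`. -/
def U (a b : A) : A := (2 : ℝ) • (a * (a * b)) - (a * a) * b

/-- A minimal (atomic) projection: a nonzero idempotent `p` with `U_p(A) = ℝ p`. -/
def IsMinimalProjection (p : A) : Prop :=
  p * p = p ∧ p ≠ 0 ∧ Set.range (U p) = Set.range (fun r : ℝ => r • p)

variable (A)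

/-- The center: all elements that operator commute with every element. -/
def center : Set A := {z | ∀ a : A, OperatorCommute z a}

/-- A factor: a nonzero algebra whose center is trivial, that is, consists of the multiples
of the unit. -/
def IsFactor : Prop := (1 : A) ≠ 0 ∧ center A = Set.range (fun r : ℝ => r • (1 : A))

/-- A factor of Type `I₂`: a factor whose unit is the sum of two orthogonal minimal projections. -/
def IsTypeI2Factor : Prop :=
  IsFactor A ∧ ∃ p q : A, IsMinimalProjection p ∧ IsMinimalProjection q ∧ p * q = 0 ∧ p + q = 1

end

/-- The product `(a + λ1) ∘ (b + μ1) = (μ a + λ b) + (⟪a, b⟫ + λ μ) 1` on `H ⊕ ℝ1`. The type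
`WithLp 1 (H × ℝ)` carries the norm `‖a + λ1‖ = ‖a‖ + |λ|`. -/
noncomputable def spinMul {H : Type u} [NormedAddCommGroup H] [InnerProductSpace ℝ H]
    (x y : WithLp 1 (H × ℝ)) : WithLp 1 (H × ℝ) :=
  WithLp.toLp 1 (y.snd • x.fst + x.snd • y.fst, inner ℝ x.fst y.fst + x.snd * y.snd)

/-- `A` is a spin factor: isometrically Jordan isomorphic to `H ⊕ ℝ1` for a real Hilbert space `H`
of (finite or infinite) dimension at least two. -/
def IsSpinFactor (A : Type u) [JBAlgebra A] : Prop :=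
  ∃ (H : Type u) (_ : NormedAddCommGroup H) (_ : InnerProductSpace ℝ H) (_ : CompleteSpace H),
    2 ≤ Module.rank ℝ H ∧
      ∃ e : A ≃ₗᵢ[ℝ] WithLp 1 (H × ℝ), ∀ x y : A, e (x * y) = spinMul (e x) (e y)

/-- `A ≅ ℝ ⊕ ℝ`: isometric Jordan isomorphism onto `ℝ × ℝ` with coordinatewise product and
maximum norm. -/
def IsRealSumReal (A : Type u) [JBAlgebra A] : Prop :=
  ∃ e : A ≃ₗᵢ[ℝ] ℝ × ℝ, ∀ x y : A, e (x * y) = e x * e y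

end JBAlgebra

/-! ### Norm estimates and Peirce calculus of an idempotent -/

namespace JBAlgebra

section

variable {A : Type u} [JBAlgebra A]

/-! A two-dimensional C is spanned by 1 and a symmetry v, hence by the complementary idempotents p,
q = (1 ± v)/2. Maximality makes both minimal: an element of the Peirce 1-space of p generates with 1
and p an associative algebra (`exists_mem_ASU`) containing C. Conversely, an associative algebra
containing complementary minimal projections p, q has only elements x = px + qx in ℝp + ℝq. Given
such p, q, a non-scalar central element makes p central, which forces A = ℝp + ℝq; otherwise A is a
factor.

For the spin structure, set V = {v : 2p∘v − v ∈ ℝ1} (`spinSubmodule`), which is ℝ(2p − 1) plus the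
Peirce 1/2-space of p. The Jordan identity makes squares in V scalar, so v² = ‖v‖²1; this yields an
inner product on V, and A = V ⊕ ℝ1 with the required norm. In a spin factor, (1 ± h)/2 with h a unit
vector are the minimal projections. -/

instance instIsScalarTowerReal : IsScalarTower ℝ A A := ⟨fun r a b => smul_mul' r a b⟩

instance instSMulCommClassReal : SMulCommClass ℝ A A :=
  ⟨fun r a b => by simp only [smul_eq_mul]; rw [mul_comm a, mul_comm a, smul_mul']⟩

/-- The full linearization of the Jordan identity. -/
theorem linearized_jordan (a b c d : A) :
    a * ((b * c) * d) + b * ((c * a) * d) + c * ((a * b) * d) =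
      (b * c) * (a * d) + (c * a) * (b * d) + (a * b) * (c * d) := by
  have h := DFunLike.congr_fun (two_nsmul_lie_lmul_lmul_add_add_eq_zero a b c) d
  have h2 : (2 : ℝ) • (a * ((b * c) * d) + b * ((c * a) * d) + c * ((a * b) * d)) =
      (2 : ℝ) • ((b * c) * (a * d) + (c * a) * (b * d) + (a * b) * (c * d)) := by
    simp only [Ring.lie_def] at h
    change (2 : ℕ) • ((a * ((b * c) * d) - (b * c) * (a * d)) + (b * ((c * a) * d) -
      (c * a) * (b * d)) + (c * ((a * b) * d) - (a * b) * (c * d))) = 0 at h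
    linear_combination (norm := module) h
  exact smul_right_injective A (two_ne_zero' ℝ) h2

theorem norm_one_eq (h : (1 : A) ≠ 0) : ‖(1 : A)‖ = 1 := by
  have h1 := norm_sq' (1 : A)
  rw [mul_one] at h1
  have : ‖(1 : A)‖ ≠ 0 := norm_ne_zero_iff.2 h
  have h2 : ‖(1 : A)‖ * (‖(1 : A)‖ - 1) = 0 := by linear_combination -h1
  rcases mul_eq_zero.1 h2 with h | h
  · contradiction
  · linarith

/-- A nonzero element whose square is a multiple of the unit has positive square. -/
theorem pos_of_mul_self_eq_smul_one {x : A} {r : ℝ} (hx : x ≠ 0) (h : x * x = r • (1 : A)) :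
    0 < r := by
  by_contra! hr
  -- For r ≤ 0 the squares of x and √(-r)·1 add up to 0, so ‖x²‖ ≤ 0.
  have h1 := norm_sq_le' x (Real.sqrt (-r) • (1 : A))
  rw [smul_mul_smul_comm, mul_one, Real.mul_self_sqrt (by linarith), h, ← add_smul,
    add_neg_cancel, zero_smul, norm_zero, ← h, norm_sq'] at h1
  have : 0 < ‖x‖ := norm_pos_iff.2 hx
  nlinarith

theorem norm_idempotent {e : A} (he : e * e = e) (h0 : e ≠ 0) : ‖e‖ = 1 := by
  have h1 := norm_sq' e
  rw [he] at h1
  have : ‖e‖ ≠ 0 := norm_ne_zero_iff.2 h0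
  have h2 : ‖e‖ * (‖e‖ - 1) = 0 := by linear_combination -h1
  rcases mul_eq_zero.1 h2 with h | h
  · contradiction
  · linarith

/-- Both bounds use ‖a²‖ ≤ ‖a² + b²‖ on the square α²e + β²f: adding (α² − β²)f completes it to α²1,
and it is itself α²e plus the square of βf. -/
theorem norm_combination_of_abs_le {e f : A} (he : e * e = e) (hf : f * f = f) (hef : e * f = 0)
    (h1 : e + f = 1) (he0 : e ≠ 0) {α β : ℝ} (h : |β| ≤ |α|) : ‖α • e + β • f‖ = |α| := by
  have hfe : f * e = 0 := by rw [mul_comm, hef]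
  have one_ne : (1 : A) ≠ 0 := fun h => he0 (by rw [← one_mul e, h, zero_mul])
  have sq : (α • e + β • f) * (α • e + β • f) = (α ^ 2) • e + (β ^ 2) • f := by
    simp only [mul_add, add_mul, smul_mul_smul_comm, he, hf, hef, hfe]
    module
  have hn := norm_sq' (α • e + β • f)
  have hs : β ^ 2 ≤ α ^ 2 := sq_le_sq.2 h
  apply le_antisymm
  · apply abs_le_of_sq_le_sq' _ (abs_nonneg _) |>.2
    rw [← hn]
    refine (norm_sq_le' _ (Real.sqrt (α ^ 2 - β ^ 2) • f)).trans ?_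
    rw [smul_mul_smul_comm, Real.mul_self_sqrt (by linarith), hf, sq]
    have : α ^ 2 • e + β ^ 2 • f + (α ^ 2 - β ^ 2) • f = α ^ 2 • (1 : A) := by
      rw [← h1]; module
    rw [this, norm_smul, norm_one_eq one_ne]
    simp
  · apply abs_le_of_sq_le_sq' _ (norm_nonneg _) |>.2
    rw [← hn, sq]
    have h2 := norm_sq_le' (α • e) (β • f)
    rw [smul_mul_smul_comm, smul_mul_smul_comm, he, hf, norm_smul, norm_idempotent he he0] at h2
    simpa [← pow_two] using h2

/-- The norm of a combination of complementary nonzero idempotents. -/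
theorem norm_combination {e f : A} (he : e * e = e) (hf : f * f = f) (hef : e * f = 0)
    (h1 : e + f = 1) (he0 : e ≠ 0) (hf0 : f ≠ 0) (α β : ℝ) :
    ‖α • e + β • f‖ = max |α| |β| := by
  rcases le_total |β| |α| with h | h
  · rw [norm_combination_of_abs_le he hf hef h1 he0 h, max_eq_left h]
  · rw [add_comm, norm_combination_of_abs_le hf he (by rw [mul_comm, hef])
      (by rw [add_comm, h1]) hf0 h, max_eq_right h]

theorem linearIndependent_idempotents {e f : A} (he : e * e = e) (hf : f * f = f)
    (hef : e * f = 0) (he0 : e ≠ 0) (hf0 : f ≠ 0) : LinearIndependent ℝ ![e, f] := by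
  rw [LinearIndependent.pair_iff]
  intro s t h
  have h1 : e * (s • e + t • f) = 0 := by rw [h, mul_zero]
  have h2 : f * (s • e + t • f) = 0 := by rw [h, mul_zero]
  rw [mul_add, mul_smul_comm, mul_smul_comm, he, hef] at h1
  rw [mul_add, mul_smul_comm, mul_smul_comm, hf, mul_comm, hef] at h2
  simp only [smul_zero, add_zero, zero_add, smul_eq_zero, he0, hf0, or_false] at h1 h2
  exact ⟨h1, h2⟩

/-- The Peirce polynomial of an idempotent. -/
theorem peirce_cubic {p : A} (hp : p * p = p) (c : A) :
    (2 : ℝ) • (p * (p * (p * c))) = (3 : ℝ) • (p * (p * c)) - p * c := by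
  -- For T = T_p this reads 2T³ − 3T² + T = 0, so the eigenvalues of T lie in {0, 1/2, 1}.
  have h := linearized_jordan p p c p
  simp only [mul_comm c, mul_comm (p * c) p, hp] at h
  linear_combination (norm := module) h

/-- An element of the Peirce `1/2`-space has a square that operator commutes with `p`. -/
theorem operatorCommute_sq_of_half {p x : A} (hx : p * x = (1 / 2 : ℝ) • x) :
    OperatorCommute p (x * x) := by
  intro c
  -- The term x∘(x∘c) appears on both sides and cancels.
  have h := linearized_jordan x x p c
  rw [hx, mul_comm x p, hx, smul_mul_assoc, mul_smul_comm, smul_mul_assoc] at h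
  linear_combination (norm := module) h

/-- An element of the Peirce `1`-space operator commutes with `p`. -/
theorem operatorCommute_of_mul_eq {p a : A} (hp : p * p = p) (ha : p * a = a) :
    OperatorCommute p a := by
  intro c
  have h := linearized_jordan p p a c
  rw [mul_comm a p, ha, hp] at h
  linear_combination (norm := module) h

end

end JBAlgebra

/-! ### Minimal projections and operator commutation -/

namespace JBAlgebra

section

variable {A : Type u} [JBAlgebra A]

theorem U_of_idempotent {p : A} (hp : p * p = p) (c : A) :
    U p c = (2 : ℝ) • (p * (p * c)) - p * c := by
  rw [U, hp]

/-- U_p = T_p(2T_p − 1), and the Peirce cubic is (T_p − 1)U_p = 0. Hence U_p maps into the Peirce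
1-space. -/
theorem mul_U_of_idempotent {p : A} (hp : p * p = p) (c : A) : p * U p c = U p c := by
  rw [U_of_idempotent hp, mul_sub, mul_smul_comm, peirce_cubic hp]
  module

theorem U_of_mul_eq {p a : A} (hp : p * p = p) (ha : p * a = a) : U p a = a := by
  rw [U_of_idempotent hp, ha, ha]
  module

/-- The hypothesis says that `a` has no Peirce 1/2-component. -/
theorem U_of_mul_mul_eq {p a : A} (hp : p * p = p) (ha : p * (p * a) = p * a) :
    U p a = p * a := by
  rw [U_of_idempotent hp, ha]
  module

theorem OperatorCommute.symm {a b : A} (h : OperatorCommute a b) : OperatorCommute b a :=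
  fun c => (h c).symm

theorem IsMinimalProjection.exists_U_eq {p : A} (h : IsMinimalProjection p) (c : A) :
    ∃ r : ℝ, U p c = r • p := by
  have : U p c ∈ Set.range (fun r : ℝ => r • p) := h.2.2 ▸ Set.mem_range_self c
  obtain ⟨r, hr⟩ := this
  exact ⟨r, hr.symm⟩

theorem isMinimalProjection_of_forall {p : A} (hp : p * p = p) (h0 : p ≠ 0)
    (h : ∀ a, p * a = a → ∃ r : ℝ, a = r • p) : IsMinimalProjection p := by
  refine ⟨hp, h0, Set.Subset.antisymm ?_ ?_⟩
  · rintro _ ⟨c, rfl⟩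
    obtain ⟨r, hr⟩ := h _ (mul_U_of_idempotent hp c)
    exact ⟨r, hr.symm⟩
  · rintro _ ⟨r, rfl⟩
    exact ⟨r • p, U_of_mul_eq hp (by rw [mul_smul_comm, hp])⟩

/-- A product `a (a y)` operator commutes with everything that operator commutes with
`a`, `a²`, `y` and `a y`. -/
theorem OperatorCommute.mul_mul {x a y : A} (h1 : OperatorCommute x a)
    (h2 : OperatorCommute x (a * a)) (h3 : OperatorCommute x y) (h4 : OperatorCommute x (a * y)) :
    OperatorCommute x (a * (a * y)) := by
  -- Multiplication by a(ay) is a polynomial in the multiplications by a, a², y and ay, all of which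
  -- commute with T_x.
  have key : ∀ c, (a * (a * y)) * c =
      (2 : ℝ) • ((a * y) * (a * c)) + (a * a) * (y * c) - a * (a * (y * c)) - y * (a * (a * c)) := by
    intro c
    have h := linearized_jordan c a y a
    rw [mul_comm c, mul_comm (a * y) a, mul_comm (y * c) a, mul_comm (c * a) a, mul_comm c a,
      mul_comm (y * c) (a * a), mul_comm (a * c) (y * a), mul_comm y a] at h
    linear_combination (norm := module) h
  intro c
  rw [key, key, mul_sub, mul_sub, mul_add, mul_smul_comm, h4, h1, h2, h3, h1, h1, h3, h3, h1, h1]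

/-- The powers of an element `a` of the Peirce `1`-space of `p`, starting with `a⁰ = p`. -/
def peircePow (p a : A) : ℕ → A
  | 0 => p
  | n + 1 => a * peircePow p a n

theorem OperatorCommute.peircePow {p a x : A} (ha : p * a = a) (h0 : OperatorCommute x p)
    (h1 : OperatorCommute x a) (h2 : OperatorCommute x (a * a)) (n : ℕ) :
    OperatorCommute x (peircePow p a n) := by
  -- `OperatorCommute.mul_mul` needs both y and ay, so the induction carries two consecutive powers.
  have : OperatorCommute x (JBAlgebra.peircePow p a n) ∧
      OperatorCommute x (JBAlgebra.peircePow p a (n + 1)) := by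
    induction n with
    | zero =>
      refine ⟨h0, ?_⟩
      rw [JBAlgebra.peircePow, JBAlgebra.peircePow, mul_comm, ha]
      exact h1
    | succ n ih => exact ⟨ih.2, OperatorCommute.mul_mul h1 h2 ih.1 ih.2⟩
  exact this.1

theorem operatorCommute_self_sq (a : A) : OperatorCommute a (a * a) := by
  intro c
  have h := linearized_jordan a a a c
  have h3 : (3 : ℝ) • (a * (a * a * c)) = (3 : ℝ) • (a * a * (a * c)) := by
    linear_combination (norm := module) h
  exact smul_right_injective A (three_ne_zero' ℝ) h3

/-- The previous induction is used twice: with x = p, a, a², then with x a power of a, whose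
hypotheses the first round supplies. -/
theorem operatorCommute_peircePow {p a : A} (hp : p * p = p) (ha : p * a = a) (m n : ℕ) :
    OperatorCommute (peircePow p a m) (peircePow p a n) := by
  have hpa : OperatorCommute p a := operatorCommute_of_mul_eq hp ha
  have hpa2 : OperatorCommute p (a * a) := operatorCommute_of_mul_eq hp (by rw [hpa, ha])
  have hp1 := fun n => OperatorCommute.peircePow ha (fun _ => rfl) hpa hpa2 n
  have hp2 := fun n => OperatorCommute.peircePow ha hpa.symm (fun _ => rfl)
    (operatorCommute_self_sq a) n
  have hp3 := fun n => OperatorCommute.peircePow ha hpa2.symm (operatorCommute_self_sq a).symm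
    (fun _ => rfl) n
  exact OperatorCommute.peircePow ha (hp1 m).symm (hp2 m).symm (hp3 m).symm n

theorem peircePow_mul {p a : A} (hp : p * p = p) (ha : p * a = a) (m n : ℕ) :
    peircePow p a m * peircePow p a n = peircePow p a (m + n) := by
  induction m with
  | zero =>
    rw [zero_add]
    induction n with
    | zero => exact hp
    | succ n ih =>
      have h : OperatorCommute p a := operatorCommute_of_mul_eq hp ha
      rw [peircePow] at ih ⊢
      rw [peircePow, h, ih]
  | succ m ih =>
    have h : OperatorCommute (peircePow p a 1) (peircePow p a n) :=
      operatorCommute_peircePow hp ha 1 n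
    have h1 : peircePow p a 1 = a := by rw [peircePow, peircePow, mul_comm, ha]
    rw [h1] at h
    rw [Nat.add_right_comm, peircePow, peircePow, mul_comm, ← h, mul_comm _ (peircePow p a m), ih]

/-- The product as a continuous bilinear map. -/
noncomputable def mulL (A : Type u) [JBAlgebra A] : A →L[ℝ] A →L[ℝ] A :=
  (LinearMap.mul ℝ A).mkContinuous₂ 1 fun a b => by
    rw [one_mul]; exact norm_mul_le' a b

instance instContinuousMul : ContinuousMul A := ⟨(mulL A).continuous₂⟩

/-- A multiplicatively closed set of pairwise operator commuting elements generates a unital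
associative closed subalgebra. -/
theorem exists_mem_ASU_of_operatorCommute {G : Set A} (h1 : (1 : A) ∈ G)
    (hc : ∀ x ∈ G, ∀ y ∈ G, OperatorCommute x y) (hm : ∀ x ∈ G, ∀ y ∈ G, x * y ∈ G) :
    ∃ D ∈ ASU A, G ⊆ D := by
  set S := Submodule.span ℝ G with hS
  have hcS : ∀ x ∈ S, ∀ y ∈ S, OperatorCommute x y := by
    intro x hx y hy c
    induction hx, hy using Submodule.span_induction₂ with
    | mem_mem x y hx hy => exact hc x hx y hy c
    | zero_left y hy => simp
    | zero_right x hx => simp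
    | add_left x y z _ _ _ h1 h2 => rw [add_mul, h1, h2, add_mul, mul_add]
    | add_right x y z _ _ _ h1 h2 => rw [add_mul, mul_add, h1, h2, add_mul]
    | smul_left r x y _ _ h => rw [smul_mul_assoc, smul_mul_assoc, mul_smul_comm, h]
    | smul_right r x y _ _ h => rw [smul_mul_assoc, smul_mul_assoc, mul_smul_comm, h]
  have hmS : ∀ x ∈ S, ∀ y ∈ S, x * y ∈ S := by
    intro x hx y hy
    induction hx, hy using Submodule.span_induction₂ with
    | mem_mem x y hx hy => exact Submodule.subset_span (hm x hx y hy)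
    | zero_left y hy => simp
    | zero_right x hx => simp
    | add_left x y z _ _ _ h1 h2 => rw [add_mul]; exact add_mem h1 h2
    | add_right x y z _ _ _ h1 h2 => rw [mul_add]; exact add_mem h1 h2
    | smul_left r x y _ _ h => rw [smul_mul_assoc]; exact S.smul_mem r h
    | smul_right r x y _ _ h => rw [mul_smul_comm]; exact S.smul_mem r h
  have hcl : ∀ x ∈ closure (S : Set A), ∀ y ∈ closure (S : Set A), OperatorCommute x y := by
    intro x hx y hy c
    have h := map_mem_closure₂ (f := fun x y : A => x * (y * c) - y * (x * c)) (by fun_prop)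
      hx hy (u := {0}) fun a ha b hb => sub_eq_zero.2 (hcS a ha b hb c)
    rw [closure_singleton] at h
    exact sub_eq_zero.1 h
  let D : NonUnitalSubalgebra ℝ A :=
    { S.topologicalClosure with
      mul_mem' := fun {x y} hx hy => map_mem_closure₂ continuous_mul hx hy hmS }
  refine ⟨D, ⟨isClosed_closure, subset_closure (Submodule.subset_span h1), ?_⟩,
    Submodule.subset_span.trans subset_closure⟩
  intro x hx y hy z hz
  -- By commutativity, (xy)z = x(yz) is T_z T_x = T_x T_z evaluated at y.
  rw [mul_comm, hcl z hz x hx, mul_comm z]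

/-- An idempotent and an element of its Peirce `1`-space lie in a common unital associative
closed subalgebra. -/
theorem exists_mem_ASU {p a : A} (hp : p * p = p) (ha : p * a = a) :
    ∃ D ∈ ASU A, p ∈ D ∧ a ∈ D := by
  obtain ⟨D, hD, hG⟩ := exists_mem_ASU_of_operatorCommute
    (G := insert 1 (Set.range (peircePow p a))) (Set.mem_insert _ _) (by
      rintro x (rfl | ⟨m, rfl⟩) y (rfl | ⟨n, rfl⟩) c
      · rfl
      · simp
      · simp
      · exact operatorCommute_peircePow hp ha m n c) (by
      rintro x (rfl | ⟨m, rfl⟩) y (rfl | ⟨n, rfl⟩)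
      · simp
      · simp
      · simp
      · rw [peircePow_mul hp ha]
        exact Or.inr ⟨_, rfl⟩)
  refine ⟨D, hD, hG (Or.inr ⟨0, rfl⟩), hG (Or.inr ⟨1, ?_⟩)⟩
  rw [peircePow, peircePow, mul_comm, ha]

/-! ### Complementary idempotents and two-dimensional maximal subalgebras -/

theorem idempotents_of_mul_self_eq_one {v : A} (h : v * v = 1) :
    ((1 / 2 : ℝ) • (1 + v)) * ((1 / 2 : ℝ) • (1 + v)) = (1 / 2 : ℝ) • (1 + v) ∧
    ((1 / 2 : ℝ) • (1 - v)) * ((1 / 2 : ℝ) • (1 - v)) = (1 / 2 : ℝ) • (1 - v) ∧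
    ((1 / 2 : ℝ) • (1 + v)) * ((1 / 2 : ℝ) • (1 - v)) = 0 ∧
    (1 / 2 : ℝ) • (1 + v) + (1 / 2 : ℝ) • (1 - v) = 1 := by
  refine ⟨?_, ?_, ?_, ?_⟩
  all_goals
    try simp only [smul_mul_smul_comm, add_mul, sub_mul, mul_add, mul_sub, mul_one, one_mul, h]
    module

/-- Complementary nonzero idempotents. -/
structure IsComplementary (p q : A) : Prop where
  left : p * p = p
  right : q * q = q
  mul : p * q = 0
  add : p + q = 1
  left_ne : p ≠ 0
  right_ne : q ≠ 0

theorem IsComplementary.symm {p q : A} (h : IsComplementary p q) : IsComplementary q p :=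
  ⟨h.right, h.left, by rw [mul_comm, h.mul], by rw [add_comm, h.add], h.right_ne, h.left_ne⟩

theorem isComplementary_of_mul_self_eq_one {v : A} (h : v * v = 1) (h1 : v ≠ 1) (h2 : v ≠ -1) :
    IsComplementary ((1 / 2 : ℝ) • (1 + v)) ((1 / 2 : ℝ) • (1 - v)) := by
  obtain ⟨ha, hb, hc, hd⟩ := idempotents_of_mul_self_eq_one h
  refine ⟨ha, hb, hc, hd, fun h0 => h2 ?_, fun h0 => h1 ?_⟩
  · rw [smul_eq_zero_iff_right (by norm_num)] at h0
    exact eq_neg_of_add_eq_zero_right h0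
  · rw [smul_eq_zero_iff_right (by norm_num)] at h0
    exact (sub_eq_zero.1 h0).symm

/-- A two-dimensional associative unital subalgebra is spanned by complementary idempotents. -/
theorem exists_isComplementary_of_finrank_eq_two {C : NonUnitalSubalgebra ℝ A} (hC : C ∈ ASU A)
    (h2 : Module.finrank ℝ C = 2) :
    ∃ p q : A, IsComplementary p q ∧ ∀ x ∈ C, ∃ α β : ℝ, x = α • p + β • q := by
  have hex : ∃ a ∈ C, ∀ r : ℝ, r • (1 : A) ≠ a := by
    by_contra! h
    have := finrank_le_one (R := ℝ) (⟨1, hC.2.1⟩ : C) fun w => by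
      obtain ⟨r, hr⟩ := h w w.2
      exact ⟨r, Subtype.ext hr⟩
    omega
  obtain ⟨a, haC, ha⟩ := hex
  have one_ne : (1 : A) ≠ 0 := fun h => ha 0 (by rw [← one_mul a, h]; simp)
  have hli : LinearIndependent ℝ ![(⟨1, hC.2.1⟩ : C), ⟨a, haC⟩] := by
    rw [LinearIndependent.pair_iff' (fun h => one_ne (congrArg Subtype.val h))]
    exact fun r h => ha r (congrArg Subtype.val h)
  have hspan := hli.span_eq_top_of_card_eq_finrank (by simp [h2])
  have hrep : ∀ x ∈ C, ∃ α β : ℝ, x = α • (1 : A) + β • a := by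
    intro x hx
    have : (⟨x, hx⟩ : C) ∈ Submodule.span ℝ (Set.range ![(⟨1, hC.2.1⟩ : C), ⟨a, haC⟩]) := by
      rw [hspan]; trivial
    rw [Matrix.range_cons_cons_empty, Submodule.mem_span_pair] at this
    obtain ⟨α, β, h⟩ := this
    exact ⟨α, β, (congrArg Subtype.val h).symm⟩
  obtain ⟨α, β, hsq⟩ := hrep (a * a) (C.mul_mem haC haC)
  -- Completing the square in a² = α1 + βa.
  have hx0 : a - (β / 2) • (1 : A) ≠ 0 := fun h => ha (β / 2) (sub_eq_zero.1 h).symm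
  have hx : (a - (β / 2) • (1 : A)) * (a - (β / 2) • (1 : A)) = (α + β ^ 2 / 4) • (1 : A) := by
    simp only [sub_mul, mul_sub, mul_smul_comm, smul_mul_assoc, mul_one, one_mul, hsq]
    module
  -- Positivity rules out the complex and the dual numbers, and permits normalising to a symmetry v.
  have hpos := pos_of_mul_self_eq_smul_one hx0 hx
  set r := Real.sqrt (α + β ^ 2 / 4) with hr
  have hr0 : 0 < r := Real.sqrt_pos.2 hpos
  have hrr : r * r = α + β ^ 2 / 4 := Real.mul_self_sqrt hpos.le
  set v := r⁻¹ • (a - (β / 2) • (1 : A)) with hv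
  have hav : a = r • v + (β / 2) • (1 : A) := by
    rw [hv, smul_inv_smul₀ hr0.ne']; module
  have hvv : v * v = 1 := by
    rw [hv, smul_mul_smul_comm, hx, ← hrr, smul_smul]
    have : r⁻¹ * r⁻¹ * (r * r) = 1 := by field_simp
    rw [this, one_smul]
  refine ⟨_, _, isComplementary_of_mul_self_eq_one hvv ?_ ?_, ?_⟩
  · intro h
    apply ha (r + β / 2)
    rw [hav, h]; module
  · intro h
    apply ha (-r + β / 2)
    rw [hav, h]; module
  · intro x hxC
    obtain ⟨s, t, rfl⟩ := hrep x hxC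
    -- Substitute a = rv + β/2, v = p − q and 1 = p + q.
    refine ⟨s + t * (β / 2) + t * r, s + t * (β / 2) - t * r, ?_⟩
    rw [hav]; module

/-- If pa = a, then p and a lie in an associative D. It contains q = 1 − p, hence C, so a ∈ C by
maximality, and pa = a kills the q-coefficient. -/
theorem isMinimalProjection_of_maximal {C : NonUnitalSubalgebra ℝ A}
    (hC : Maximal (fun D : NonUnitalSubalgebra ℝ A => D ∈ ASU A) C) {p q : A}
    (h : IsComplementary p q) (hrep : ∀ x ∈ C, ∃ α β : ℝ, x = α • p + β • q) :
    IsMinimalProjection p := by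
  refine isMinimalProjection_of_forall h.left h.left_ne fun a ha => ?_
  obtain ⟨D, hD, hpD, haD⟩ := exists_mem_ASU h.left ha
  have hqD : q ∈ D := by
    rw [← sub_eq_of_eq_add' h.add.symm]; exact sub_mem hD.2.1 hpD
  have hCD : C ≤ D := by
    intro x hx
    obtain ⟨α, β, rfl⟩ := hrep x hx
    exact add_mem (D.smul_mem α hpD) (D.smul_mem β hqD)
  obtain ⟨α, β, hab⟩ := hrep a (hC.2 hD hCD haD)
  refine ⟨α, ?_⟩
  rw [hab, mul_add, mul_smul_comm, mul_smul_comm, h.left, h.mul, smul_zero, add_zero] at ha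
  rw [hab, ← ha]

/-- Two complementary minimal projections span a maximal associative subalgebra. -/
theorem exists_maximal_of_isMinimalProjection {p q : A} (hp : IsMinimalProjection p)
    (hq : IsMinimalProjection q) (hpq : p * q = 0) (h1 : p + q = 1) :
    ∃ C : NonUnitalSubalgebra ℝ A,
      Maximal (fun D : NonUnitalSubalgebra ℝ A => D ∈ ASU A) C ∧ Module.finrank ℝ C = 2 := by
  have hqp : q * p = 0 := by rw [mul_comm, hpq]
  have hmul : ∀ s t s' t' : ℝ, (s • p + t • q) * (s' • p + t' • q) =
      (s * s') • p + (t * t') • q := by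
    intro s t s' t'
    simp only [mul_add, add_mul, smul_mul_smul_comm, hp.1, hq.1, hpq, hqp]
    module
  let C : NonUnitalSubalgebra ℝ A :=
    { Submodule.span ℝ {p, q} with
      mul_mem' := by
        intro x y hx hy
        obtain ⟨s, t, rfl⟩ := Submodule.mem_span_pair.1 hx
        obtain ⟨s', t', rfl⟩ := Submodule.mem_span_pair.1 hy
        exact Submodule.mem_span_pair.2 ⟨_, _, (hmul s t s' t').symm⟩ }
  have hmem : ∀ x, x ∈ C ↔ ∃ s t : ℝ, s • p + t • q = x := fun x => Submodule.mem_span_pair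
  have hASU : C ∈ ASU A := by
    have : FiniteDimensional ℝ (Submodule.span ℝ {p, q}) :=
      FiniteDimensional.span_of_finite ℝ (Set.toFinite _)
    refine ⟨(Submodule.span ℝ {p, q}).closed_of_finiteDimensional, ?_, ?_⟩
    · rw [hmem]
      exact ⟨1, 1, by rw [one_smul, one_smul, h1]⟩
    · intro x hx y hy z hz
      obtain ⟨s, t, rfl⟩ := (hmem x).1 hx
      obtain ⟨s', t', rfl⟩ := (hmem y).1 hy
      obtain ⟨s'', t'', rfl⟩ := (hmem z).1 hz
      simp only [hmul, mul_assoc]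
  refine ⟨C, ⟨hASU, fun D hD hCD a ha => ?_⟩, ?_⟩
  · have hpD : p ∈ D := hCD ((hmem p).2 ⟨1, 0, by simp⟩)
    have hqD : q ∈ D := hCD ((hmem q).2 ⟨0, 1, by simp⟩)
    -- Associativity of D gives p(pa) = pa, so pa = U_p a ∈ ℝp; likewise for q.
    obtain ⟨r, hr⟩ := hp.exists_U_eq a
    obtain ⟨s, hs⟩ := hq.exists_U_eq a
    rw [U_of_mul_mul_eq hp.1 (by rw [← hD.2.2 p hpD p hpD a ha, hp.1])] at hr
    rw [U_of_mul_mul_eq hq.1 (by rw [← hD.2.2 q hqD q hqD a ha, hq.1])] at hs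
    exact (hmem a).2 ⟨r, s, by rw [← hr, ← hs, ← add_mul, h1, one_mul]⟩
  · have h := finrank_span_eq_card
      (linearIndependent_idempotents hp.1 hq.1 hpq hp.2.1 hq.2.1)
    rw [Matrix.range_cons_cons_empty] at h
    exact h

/-! ### The dichotomy: factor or ℝ ⊕ ℝ -/

theorem isRealSumReal_of_forall_exists {p q : A} (h : IsComplementary p q)
    (hrep : ∀ x : A, ∃ α β : ℝ, x = α • p + β • q) : IsRealSumReal A := by
  let f : ℝ × ℝ →ₗᵢ[ℝ] A :=
    { toFun := fun x => x.1 • p + x.2 • q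
      map_add' := fun x y => by simp only [Prod.fst_add, Prod.snd_add]; module
      map_smul' := fun r x => by
        simp only [Prod.smul_fst, Prod.smul_snd, smul_eq_mul, RingHom.id_apply]; module
      norm_map' := fun x => norm_combination h.left h.right h.mul h.add h.left_ne h.right_ne _ _ }
  have hf : ∀ x, f x = x.1 • p + x.2 • q := fun _ => rfl
  have hs : Function.Surjective f := by
    intro x
    obtain ⟨α, β, rfl⟩ := hrep x
    exact ⟨(α, β), rfl⟩
  let e := LinearIsometryEquiv.ofSurjective f hs
  have he : ∀ x, e x = f x := fun _ => rfl
  refine ⟨e.symm, fun x y => e.injective ?_⟩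
  obtain ⟨x, rfl⟩ := e.surjective x
  obtain ⟨y, rfl⟩ := e.surjective y
  simp only [LinearIsometryEquiv.symm_apply_apply, LinearIsometryEquiv.apply_symm_apply]
  simp only [he, hf, mul_add, add_mul, smul_mul_smul_comm, h.left, h.right, h.mul,
    mul_comm q p, Prod.fst_mul, Prod.snd_mul]
  module

theorem smul_one_mem_center (r : ℝ) : r • (1 : A) ∈ center A := by
  intro a c
  rw [smul_mul_assoc, smul_mul_assoc, one_mul, one_mul, mul_smul_comm]

/-- An algebra with complementary minimal projections is a factor or `ℝ ⊕ ℝ`. -/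
theorem isTypeI2Factor_or_isRealSumReal {p q : A} (h : IsComplementary p q)
    (hp : IsMinimalProjection p) (hq : IsMinimalProjection q) :
    IsTypeI2Factor A ∨ IsRealSumReal A := by
  by_cases hF : IsFactor A
  · exact Or.inl ⟨hF, p, q, hp, hq, h.mul, h.add⟩
  right
  have one_ne : (1 : A) ≠ 0 := fun h0 => h.left_ne (by rw [← one_mul p, h0, zero_mul])
  have hz : ∃ z ∈ center A, ∀ r : ℝ, r • (1 : A) ≠ z := by
    by_contra! hz
    refine hF ⟨one_ne, Set.Subset.antisymm hz ?_⟩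
    rintro _ ⟨r, rfl⟩
    exact smul_one_mem_center r
  obtain ⟨z, hz, hzr⟩ := hz
  have mul_mul : ∀ {e w : A}, e * e = e → w ∈ center A → e * (e * w) = e * w := by
    intro e w he hw
    rw [mul_comm e w, ← hw e e, he]
  obtain ⟨α, hα⟩ := hp.exists_U_eq z
  obtain ⟨β, hβ⟩ := hq.exists_U_eq z
  rw [U_of_mul_mul_eq hp.1 (mul_mul hp.1 hz)] at hα
  rw [U_of_mul_mul_eq hq.1 (mul_mul hq.1 hz)] at hβ
  have hzab : z = α • p + β • q := by rw [← hα, ← hβ, ← add_mul, h.add, one_mul]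
  have hne : α - β ≠ 0 := by
    intro h0
    apply hzr α
    rw [hzab, ← h.add, sub_eq_zero.1 h0, smul_add]
  -- Since α ≠ β, p is a linear combination of the central elements z and 1.
  have hpc : p ∈ center A := by
    have hpz : (α - β) • p = z - β • (1 : A) := by rw [hzab, ← h.add]; module
    intro a c
    have h1 : (α - β) • (p * (a * c)) = (α - β) • (a * (p * c)) := by
      rw [← smul_mul_assoc, ← mul_smul_comm, ← smul_mul_assoc, hpz, sub_mul, sub_mul, mul_sub,
        hz a c, smul_one_mem_center β a c]
    exact smul_right_injective A hne h1
  -- A central p has zero Peirce 1/2-space, so every x lies in ℝp + ℝq.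
  have hpp : ∀ x, p * (p * x) = p * x := by
    intro x
    have := hpc x p
    rw [hp.1, mul_comm x p] at this
    exact this
  have hqx : ∀ x, q * x = x - p * x := by
    intro x
    rw [← sub_eq_of_eq_add' h.add.symm, sub_mul, one_mul]
  refine isRealSumReal_of_forall_exists h fun x => ?_
  obtain ⟨s, hs⟩ := hp.exists_U_eq x
  obtain ⟨t, ht⟩ := hq.exists_U_eq x
  rw [U_of_mul_mul_eq hp.1 (hpp x)] at hs
  rw [U_of_mul_mul_eq hq.1 (by simp only [hqx, mul_sub, hpp]; abel)] at ht
  exact ⟨s, t, by rw [← hs, ← ht, ← add_mul, h.add, one_mul]⟩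

theorem exists_maximal_of_isRealSumReal (h : IsRealSumReal A) :
    ∃ C : NonUnitalSubalgebra ℝ A,
      Maximal (fun D : NonUnitalSubalgebra ℝ A => D ∈ ASU A) C ∧ Module.finrank ℝ C = 2 := by
  obtain ⟨e, he⟩ := h
  have he1 : e 1 = 1 := by
    have := he 1 (e.symm 1)
    rw [one_mul, e.apply_symm_apply, mul_one] at this
    exact this.symm
  have hsymm : ∀ x y, e.symm (x * y) = e.symm x * e.symm y := by
    intro x y
    apply e.injective
    rw [he]; simp
  have hmin : ∀ x : ℝ × ℝ, x * x = x → x ≠ 0 → (∀ y, x * y = y → ∃ r : ℝ, y = r • x) →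
      IsMinimalProjection (e.symm x) := by
    intro x hx h0 hr
    refine isMinimalProjection_of_forall (by rw [← hsymm, hx])
      (by simpa using h0) fun a ha => ?_
    obtain ⟨r, h⟩ := hr (e a) (by rw [← e.apply_symm_apply x, ← he, ha])
    exact ⟨r, by rw [← map_smul, ← h, e.symm_apply_apply]⟩
  refine exists_maximal_of_isMinimalProjection (p := e.symm (1, 0)) (q := e.symm (0, 1))
    (hmin _ (by simp) (by simp) ?_) (hmin _ (by simp) (by simp) ?_) ?_ ?_
  · rintro ⟨a, b⟩ h
    have h0 : b = 0 := by simpa using (congrArg Prod.snd h).symm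
    exact ⟨a, by simp [h0]⟩
  · rintro ⟨a, b⟩ h
    have h0 : a = 0 := by simpa using (congrArg Prod.fst h).symm
    exact ⟨b, by simp [h0]⟩
  · rw [← hsymm]; simp
  · rw [← map_add]
    apply e.injective
    rw [he1]; simp

end

end JBAlgebra

/-! ### From Type I₂ factors to spin factors -/

namespace JBAlgebra

section

variable {A : Type u} [JBAlgebra A]

/-- The Peirce `1/2`-space of a minimal projection with minimal complement squares into the
scalars. -/
theorem exists_sq_eq_smul_one_of_half {p q x : A} (h : IsComplementary p q)
    (hp : IsMinimalProjection p) (hq : IsMinimalProjection q) (hx : p * x = (1 / 2 : ℝ) • x) :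
    ∃ t : ℝ, x * x = t • (1 : A) := by
  by_cases hx0 : x = 0
  · exact ⟨0, by simp [hx0]⟩
  have hc := operatorCommute_sq_of_half hx
  have hqx : ∀ x, q * x = x - p * x := by
    intro x
    rw [← sub_eq_of_eq_add' h.add.symm, sub_mul, one_mul]
  have hpp : p * (p * (x * x)) = p * (x * x) := by
    have := hc p
    rw [hp.1, mul_comm (x * x) p] at this
    exact this
  obtain ⟨α, hα⟩ := hp.exists_U_eq (x * x)
  obtain ⟨β, hβ⟩ := hq.exists_U_eq (x * x)
  rw [U_of_mul_mul_eq hp.1 hpp] at hα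
  rw [U_of_mul_mul_eq hq.1 (by simp only [hqx, mul_sub, hpp]; abel)] at hβ
  have hy : x * x = α • p + β • q := by rw [← hα, ← hβ, ← add_mul, h.add, one_mul]
  -- With x² = αp + βq and px = qx = x/2, the left side is (α + β)x/4 and the right side αx/2, hence
  -- α = β.
  have hJ : (x * p) * (x * x) = x * (p * (x * x)) := IsCommJordan.lmul_comm_rmul_rmul x p
  rw [hα, mul_smul_comm, mul_comm x p, hx, hy, smul_mul_assoc, mul_comm x, add_mul,
    smul_mul_assoc, smul_mul_assoc, hqx, hx] at hJ
  have h2 : ((β - α) / 4) • x = 0 := by linear_combination (norm := module) hJ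
  have h3 : (β - α) / 4 = 0 := (smul_eq_zero.1 h2).resolve_right hx0
  have h4 : β = α := by linarith
  exact ⟨α, by rw [hy, h4, ← h.add, smul_add]⟩

/-- The elements anticommuting with the symmetry `2 p - 1`, together with its multiples. -/
def spinSubmodule (p : A) : Submodule ℝ A :=
  (Submodule.span ℝ {(1 : A)}).comap
    ((2 : ℝ) • LinearMap.mulLeft ℝ p - LinearMap.id)

theorem mem_spinSubmodule {p v : A} :
    v ∈ spinSubmodule p ↔ ∃ r : ℝ, r • (1 : A) = (2 : ℝ) • (p * v) - v := by
  simp [spinSubmodule, Submodule.mem_span_singleton]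

theorem isClosed_spinSubmodule (p : A) : IsClosed (spinSubmodule p : Set A) := by
  have : Continuous fun v : A => (2 : ℝ) • (p * v) - v := by fun_prop
  exact (Submodule.span ℝ {(1 : A)}).closed_of_finiteDimensional.preimage this

theorem one_notMem_spinSubmodule {p q : A} (h : IsComplementary p q) :
    (1 : A) ∉ spinSubmodule p := by
  rw [mem_spinSubmodule]
  rintro ⟨r, hr⟩
  have h1 : q * (r • (1 : A)) = q * ((2 : ℝ) • (p * 1) - 1) := by rw [hr]
  have h2 : p * (r • (1 : A)) = p * ((2 : ℝ) • (p * 1) - 1) := by rw [hr]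
  rw [mul_one, mul_sub, mul_smul_comm, mul_smul_comm, mul_comm q p, h.mul, mul_one] at h1
  rw [mul_one, mul_sub, mul_smul_comm, mul_smul_comm, h.left, mul_one] at h2
  have h3 : (r + 1) • q = 0 := by linear_combination (norm := module) h1
  have h4 : (r - 1) • p = 0 := by linear_combination (norm := module) h2
  have h5 := (smul_eq_zero.1 h3).resolve_right h.right_ne
  have h6 := (smul_eq_zero.1 h4).resolve_right h.left_ne
  linarith

/-- Write v = r(2p − 1) + x with x in the Peirce 1/2-space. The two parts have product 0 and scalar
squares, so v² is scalar; ‖v²‖ = ‖v‖² fixes the scalar. -/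
theorem mul_self_of_mem_spinSubmodule {p q v : A} (h : IsComplementary p q)
    (hp : IsMinimalProjection p) (hq : IsMinimalProjection q) (hv : v ∈ spinSubmodule p) :
    v * v = (‖v‖ ^ 2) • (1 : A) := by
  obtain ⟨r, hr⟩ := mem_spinSubmodule.1 hv
  have hpv : p * v = (1 / 2 : ℝ) • v + (r / 2) • (1 : A) := by
    linear_combination (norm := module) (-1 / 2 : ℝ) • hr
  set x := v - r • ((2 : ℝ) • p - 1) with hx
  have hvx : v = x + r • ((2 : ℝ) • p - 1) := by rw [hx]; module
  have hpx : p * x = (1 / 2 : ℝ) • x := by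
    rw [hx, mul_sub, mul_smul_comm, mul_sub, mul_smul_comm, h.left, mul_one, hpv]
    module
  obtain ⟨t, ht⟩ := exists_sq_eq_smul_one_of_half h hp hq hpx
  have hvv : v * v = (t + r ^ 2) • (1 : A) := by
    rw [hvx]
    simp only [mul_add, add_mul, mul_sub, sub_mul, mul_smul_comm, smul_mul_assoc, ht, mul_one,
      one_mul, mul_comm x p, hpx, h.left]
    module
  by_cases hv0 : v = 0
  · simp [hv0]
  have hpos := pos_of_mul_self_eq_smul_one hv0 hvv
  have one_ne : (1 : A) ≠ 0 := fun h => hv0 (by rw [← one_mul v, h, zero_mul])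
  have hn := norm_sq' v
  rw [hvv, norm_smul, norm_one_eq one_ne, mul_one, Real.norm_of_nonneg hpos.le] at hn
  rw [hvv, hn]

/-- For v ≠ 0, u = v/‖v‖ is a symmetry other than ±1. In terms of (1 ± u)/2 the coefficients of v +
l1 are l ± ‖v‖, and the larger modulus is ‖v‖ + |l|. -/
theorem norm_add_smul_one_of_mem_spinSubmodule {p q v : A} (h : IsComplementary p q)
    (hp : IsMinimalProjection p) (hq : IsMinimalProjection q) (hv : v ∈ spinSubmodule p) (l : ℝ) :
    ‖v + l • (1 : A)‖ = ‖v‖ + |l| := by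
  have one_ne : (1 : A) ≠ 0 := fun h0 => h.left_ne (by rw [← one_mul p, h0, zero_mul])
  by_cases hv0 : v = 0
  · simp [hv0, norm_smul, norm_one_eq one_ne]
  have hn : 0 < ‖v‖ := norm_pos_iff.2 hv0
  set u := ‖v‖⁻¹ • v with hu
  have huV : u ∈ spinSubmodule p := Submodule.smul_mem _ _ hv
  have huu : u * u = 1 := by
    rw [hu, smul_mul_smul_comm, mul_self_of_mem_spinSubmodule h hp hq hv, smul_smul]
    have : ‖v‖⁻¹ * ‖v‖⁻¹ * ‖v‖ ^ 2 = 1 := by field_simp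
    rw [this, one_smul]
  have hvu : v = ‖v‖ • u := by rw [hu, smul_inv_smul₀ hn.ne']
  have hu1 : u ≠ 1 := fun h1 => one_notMem_spinSubmodule h (h1 ▸ huV)
  have hu2 : u ≠ -1 := fun h1 => one_notMem_spinSubmodule h (by
    have := Submodule.neg_mem _ huV
    rwa [h1, neg_neg] at this)
  have hcomp := isComplementary_of_mul_self_eq_one huu hu1 hu2
  have hsum : v + l • (1 : A) = (l + ‖v‖) • ((1 / 2 : ℝ) • (1 + u)) +
      (l - ‖v‖) • ((1 / 2 : ℝ) • (1 - u)) := by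
    nth_rewrite 1 [hvu]
    module
  rw [hsum, norm_combination hcomp.left hcomp.right hcomp.mul hcomp.add hcomp.left_ne
    hcomp.right_ne]
  rcases abs_cases l with ⟨h1, h2⟩ | ⟨h1, h2⟩
  · rw [h1, max_eq_left, abs_of_nonneg (by linarith), add_comm]
    rw [abs_of_nonneg (a := l + ‖v‖) (by linarith), abs_le]
    constructor <;> linarith
  · rw [h1, max_eq_right, abs_of_nonpos (by linarith)]
    · ring
    rw [abs_of_nonpos (a := l - ‖v‖) (by linarith), abs_le]
    constructor <;> linarith

theorem exists_eq_add_smul_one {p q : A} (h : IsComplementary p q)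
    (hp : IsMinimalProjection p) (hq : IsMinimalProjection q) (a : A) :
    ∃ v ∈ spinSubmodule p, ∃ l : ℝ, a = v + l • (1 : A) := by
  obtain ⟨α, hα⟩ := hp.exists_U_eq a
  obtain ⟨β, hβ⟩ := hq.exists_U_eq a
  have hq1 : q = 1 - p := (sub_eq_of_eq_add' h.add.symm).symm
  have hc := peirce_cubic h.left a
  rw [U_of_idempotent hp.1] at hα
  rw [U_of_idempotent hq.1] at hβ
  simp only [hq1, sub_mul, one_mul, mul_sub] at hβ
  -- Here αp + βq = (α + β)/2 · 1 + (α − β)/2 · (2p − 1), and the remainder of a is its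
  -- 1/2-component.
  refine ⟨a - ((α + β) / 2) • (1 : A), mem_spinSubmodule.2 ⟨(α - β) / 2, ?_⟩, (α + β) / 2,
    by module⟩
  rw [mul_sub, mul_smul_comm, mul_one]
  linear_combination (norm := module) hβ - hα

theorem spinMul_toLp {H : Type u} [NormedAddCommGroup H] [InnerProductSpace ℝ H] (g h : H)
    (s t : ℝ) : spinMul (WithLp.toLp 1 (g, s)) (WithLp.toLp 1 (h, t)) =
      WithLp.toLp 1 (t • g + s • h, inner ℝ g h + s * t) := rfl

theorem isSpinFactor_of_isTypeI2Factor (hA : IsTypeI2Factor A) : IsSpinFactor A := by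
  obtain ⟨hF, p, q, hp, hq, hpq, h1⟩ := hA
  have h : IsComplementary p q := ⟨hp.1, hq.1, hpq, h1, hp.2.1, hq.2.1⟩
  have hsq := fun v (hv : v ∈ spinSubmodule p) => mul_self_of_mem_spinSubmodule h hp hq hv
  have : CompleteSpace (spinSubmodule p) := (isClosed_spinSubmodule p).completeSpace_coe
  have one_ne := hF.1
  -- Since v² = ‖v‖²1, the parallelogram law is the expansion of (x + y)² + (x − y)².
  let inst : InnerProductSpace ℝ (spinSubmodule p) := InnerProductSpace.ofNorm ℝ (by
    intro x y
    have hx := hsq x x.2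
    have hy := hsq y y.2
    have ha := hsq _ (x + y).2
    have hs := hsq _ (x - y).2
    simp only [Submodule.coe_add, Submodule.coe_sub, add_mul, mul_add, sub_mul, mul_sub] at ha hs
    have key : (‖x + y‖ * ‖x + y‖ + ‖x - y‖ * ‖x - y‖ -
        2 * (‖x‖ * ‖x‖ + ‖y‖ * ‖y‖)) • (1 : A) = 0 := by
      simp only [Submodule.coe_norm, Submodule.coe_add, Submodule.coe_sub]
      linear_combination (norm := module) (2 : ℝ) • hx + (2 : ℝ) • hy - ha - hs
    exact sub_eq_zero.1 ((smul_eq_zero.1 key).resolve_right one_ne))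
  have hmul : ∀ x y : spinSubmodule p, (x : A) * y = (inner ℝ x y : ℝ) • (1 : A) := by
    intro x y
    have hx := hsq x x.2
    have hy := hsq y y.2
    have ha := hsq _ (x + y).2
    rw [real_inner_eq_norm_add_mul_self_sub_norm_mul_self_sub_norm_mul_self_div_two]
    simp only [Submodule.coe_norm, Submodule.coe_add, add_mul, mul_add, mul_comm (y : A) x] at ha ⊢
    linear_combination (norm := module) (1 / 2 : ℝ) • (ha - hx - hy)
  let f : WithLp 1 (spinSubmodule p × ℝ) →ₗᵢ[ℝ] A :=
    { toFun := fun x => (x.fst : A) + x.snd • (1 : A)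
      map_add' := fun x y => by
        simp only [WithLp.add_fst, WithLp.add_snd, Submodule.coe_add]; module
      map_smul' := fun r x => by
        simp only [WithLp.smul_fst, WithLp.smul_snd, Submodule.coe_smul, smul_eq_mul,
          RingHom.id_apply]
        module
      norm_map' := fun x => by
        rw [WithLp.prod_norm_eq_of_L1]
        exact norm_add_smul_one_of_mem_spinSubmodule h hp hq x.fst.2 _ }
  have hf : ∀ x, f x = (x.fst : A) + x.snd • (1 : A) := fun _ => rfl
  have hs : Function.Surjective f := by
    intro a
    obtain ⟨v, hv, l, rfl⟩ := exists_eq_add_smul_one h hp hq a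
    exact ⟨WithLp.toLp 1 (⟨v, hv⟩, l), rfl⟩
  let e := LinearIsometryEquiv.ofSurjective f hs
  have he : ∀ x, e x = f x := fun _ => rfl
  refine ⟨spinSubmodule p, inferInstance, inst, inferInstance, ?_, e.symm, fun x y =>
    e.injective ?_⟩
  -- If dim V ≤ 1, then A is spanned by one element and 1, so p is central, hence p = r1; then rq =
  -- pq = 0 forces p = 0.
  · by_contra! hlt
    have hle : Module.rank ℝ (spinSubmodule p) ≤ 1 :=
      Order.lt_succ_iff.1 (by
        rwa [← Nat.cast_one, Cardinal.succ_natCast, Nat.cast_one, one_add_one_eq_two])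
    obtain ⟨w, hw⟩ := rank_le_one_iff.1 hle
    have hrep : ∀ a : A, ∃ s t : ℝ, a = s • (w : A) + t • (1 : A) := by
      intro a
      obtain ⟨v, hv, l, rfl⟩ := exists_eq_add_smul_one h hp hq a
      obtain ⟨r, hr⟩ := hw ⟨v, hv⟩
      exact ⟨r, l, by rw [← Submodule.coe_smul, hr]⟩
    have hpc : p ∈ center A := by
      intro a c
      obtain ⟨s, t, ha⟩ := hrep a
      obtain ⟨s', t', hb⟩ := hrep p
      rw [ha, congrArg (· * _) hb, congrArg (· * c) hb]
      simp only [add_mul, mul_add, smul_mul_assoc, mul_smul_comm, one_mul]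
      module
    rw [hF.2] at hpc
    obtain ⟨r, hr⟩ := hpc
    have h0 : r • q = 0 := by
      rw [← one_mul q, ← smul_mul_assoc]
      exact (congrArg (· * q) hr).trans hpq
    have hr0 := (smul_eq_zero.1 h0).resolve_right h.right_ne
    apply h.left_ne
    rw [← hr]
    simp [hr0]
  · obtain ⟨x, rfl⟩ := e.surjective x
    obtain ⟨y, rfl⟩ := e.surjective y
    simp only [LinearIsometryEquiv.symm_apply_apply, LinearIsometryEquiv.apply_symm_apply]
    obtain ⟨v, s⟩ := x
    obtain ⟨w, t⟩ := y
    rw [spinMul_toLp]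
    simp only [he, hf, WithLp.toLp_fst, WithLp.toLp_snd, mul_add, add_mul, mul_smul_comm, smul_mul_assoc, hmul, mul_one,
      one_mul, Submodule.coe_add, Submodule.coe_smul]
    module

/-! ### From spin factors to Type I₂ factors -/

theorem isTypeI2Factor_of_isSpinFactor (hA : IsSpinFactor A) : IsTypeI2Factor A := by
  obtain ⟨H, _, _, _, hrank, e, he⟩ := hA
  have hsymm : ∀ x y, e.symm (spinMul x y) = e.symm x * e.symm y := by
    intro x y
    apply e.injective
    rw [he]; simp
  have he1 : e 1 = WithLp.toLp 1 (0, 1) := by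
    have := he 1 (e.symm (WithLp.toLp 1 (0, 1)))
    rw [one_mul, e.apply_symm_apply] at this
    rw [this]
    simp [spinMul]
    rfl
  have hnon : ∃ h : H, h ≠ 0 := by
    by_contra! h0
    have : Module.rank ℝ H ≤ 1 := rank_le_one_iff.2 ⟨0, fun v => ⟨0, by simp [h0 v]⟩⟩
    exact absurd (hrank.trans this) (by simp)
  obtain ⟨h0, hh0⟩ := hnon
  set h := ‖h0‖⁻¹ • h0 with hh
  have hin : inner ℝ h h = (1 : ℝ) := by
    rw [real_inner_self_eq_norm_sq, hh, norm_smul, norm_inv, norm_norm,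
      inv_mul_cancel₀ (norm_ne_zero_iff.2 hh0), one_pow]
  have hmin : ∀ h : H, inner ℝ h h = (1 : ℝ) →
      IsMinimalProjection (e.symm (WithLp.toLp 1 ((1 / 2 : ℝ) • h, 1 / 2))) := by
    intro h hin
    refine isMinimalProjection_of_forall ?_ ?_ fun a ha => ?_
    · rw [← hsymm, spinMul_toLp, inner_smul_left, inner_smul_right, hin]
      congr 3
      · module
      · norm_num
    · rw [Ne, LinearIsometryEquiv.map_eq_zero_iff]
      intro h0
      have : (1 / 2 : ℝ) = 0 := congrArg WithLp.snd h0
      norm_num at this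
    · obtain ⟨⟨g, t⟩, rfl⟩ := e.symm.surjective a
      rw [← hsymm, spinMul_toLp] at ha
      have hx1 : t • ((1 / 2 : ℝ) • h) + (1 / 2 : ℝ) • g = g :=
        congrArg WithLp.fst (e.symm.injective ha)
      -- The H-component of the fixed-point equation gives g = th.
      refine ⟨2 * t, ?_⟩
      rw [← map_smul, ← WithLp.toLp_smul, Prod.smul_mk]
      congr 3
      · linear_combination (norm := module) (-2 : ℝ) • hx1
      · rw [smul_eq_mul]
        ring
  refine ⟨⟨?_, Set.Subset.antisymm ?_ ?_⟩, _, _, hmin h hin, hmin (-h) (by simpa using hin),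
    ?_, ?_⟩
  · intro h1
    rw [h1, map_zero] at he1
    exact zero_ne_one (congrArg WithLp.snd he1)
  · intro z hz
    obtain ⟨⟨w, l⟩, rfl⟩ := e.symm.surjective z
    have hw : w = 0 := by
      by_contra hne
      have hle : Module.rank ℝ H ≤ 1 := by
        refine rank_le_one_iff.2 ⟨w, fun g => ?_⟩
        -- Testing centrality of w + l1 on g and w gives ⟨g, w⟩w = ⟨w, w⟩g, so w ≠ 0 would span H.
        have h1 := hz (e.symm (WithLp.toLp 1 (g, 0))) (e.symm (WithLp.toLp 1 (w, 0)))
        simp only [← hsymm, spinMul_toLp] at h1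
        replace h1 := congrArg WithLp.fst (e.symm.injective h1)
        simp only [WithLp.toLp_fst, smul_zero, zero_smul, add_zero, zero_add,
          MulZeroClass.mul_zero] at h1
        have hin0 : (inner ℝ w w : ℝ) ≠ 0 := inner_self_ne_zero.2 hne
        refine ⟨(inner ℝ w w : ℝ)⁻¹ * inner ℝ g w, ?_⟩
        rw [mul_smul, h1, inv_smul_smul₀ hin0]
      exact absurd (hrank.trans hle) (by simp)
    refine ⟨l, e.injective ?_⟩
    simp only [map_smul, he1, e.apply_symm_apply]
    rw [← WithLp.toLp_smul, Prod.smul_mk, hw, smul_zero, smul_eq_mul, mul_one]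
  · rintro _ ⟨r, rfl⟩
    exact smul_one_mem_center r
  · rw [← hsymm, LinearIsometryEquiv.map_eq_zero_iff, spinMul_toLp, inner_smul_left,
      inner_smul_right, inner_neg_right, hin, ← WithLp.toLp_zero]
    congr 2
    · module
    · norm_num
  · rw [← map_add]
    apply e.injective
    rw [he1, e.apply_symm_apply]
    apply (WithLp.ofLp_injective 1)
    ext
    · simp
    · simp; norm_num

end

end JBAlgebra

theorem mainTheorem4 (A : Type u) [JBWAlgebra A] :
    ((∃ C : NonUnitalSubalgebra ℝ A,
        Maximal (fun D : NonUnitalSubalgebra ℝ A => D ∈ JBAlgebra.ASU A) C ∧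
          Module.finrank ℝ C = 2) ↔
      (JBAlgebra.IsTypeI2Factor A ∨ JBAlgebra.IsRealSumReal A)) ∧
    (JBAlgebra.IsTypeI2Factor A ↔ JBAlgebra.IsSpinFactor A) := by
  refine ⟨⟨?_, ?_⟩, JBAlgebra.isSpinFactor_of_isTypeI2Factor,
    JBAlgebra.isTypeI2Factor_of_isSpinFactor⟩
  · rintro ⟨C, hC, h2⟩
    obtain ⟨p, q, h, hrep⟩ := JBAlgebra.exists_isComplementary_of_finrank_eq_two hC.1 h2
    exact JBAlgebra.isTypeI2Factor_or_isRealSumReal h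
      (JBAlgebra.isMinimalProjection_of_maximal hC h hrep)
      (JBAlgebra.isMinimalProjection_of_maximal hC h.symm fun x hx => by
        obtain ⟨α, β, hx⟩ := hrep x hx
        exact ⟨β, α, by rw [hx, add_comm]⟩)
  · rintro (⟨-, p, q, hp, hq, hpq, h1⟩ | h)
    · exact JBAlgebra.exists_maximal_of_isMinimalProjection hp hq hpq h1
    · exact JBAlgebra.exists_maximal_of_isRealSumReal h
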